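/- Lemma 4.8. Let $k=\mathbb{F}_q$ be a finite field, let $X,Y$ be schemes of finite type over $k$, and let $f:X\to Y$ be a finite flat surjective morphism over $k$ of constant degree $\delta$ (i.e. $f_*\mathcal{O}_X$ is locally free over $\mathcal{O}_Y$ of constant rank $\delta$). For $S\in\{X,Y\}$ let $Z(S,t)=\exp\left(\sum_{m\ge1}\frac{\#S(\mathbb{F}_{q^m})}{m}t^m\right)$ be the Hasse–Weil zeta function, let $\mathcal{Z}^0_{\rm eff}(S)$ be the set of effective zero-cycles $\sum_i n_i x_i$ ($n_i\in\mathbb{Z}_{\ge 0}$, $x_i$ closed points of $S$), and put $\deg\left(\sum_i n_i x_i\right)=\sum_i n_i[\kappa(x_i):k]$. Write $$P(\alpha)=\frac{t^{\deg\alpha}}{Z(X,t)}\quad(\alpha\in\mathcal{Z}^0_{\rm eff}(X)),\qquad Q(\gamma)=\frac{t^{\deg\gamma}}{Z(Y,t)}\quad(\gamma\in\mathcal{Z}^0_{\rm eff}(Y)).$$ For $\gamma=\sum_i n_i y_i$ let $f^*\gamma=\sum_i n_i[f^{-1}(y_i)]$, where $[f^{-1}(y)]=\sum_{x\in f^{-1}(y)}\operatorname{length}_{\mathcal{O}_{X,x}}\left(\mathcal{O}_{X,x}/\mathfrak{m}_y\mathcal{O}_{X,x}\right)\,x$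 is the zero-cycle of the scheme-theoretic fibre. Let $d\ge 0$ be an integer with $\dim Y\le d$ and let $t$ be a real number with $0<t<q^{-d}$. Then the series $\sum_{m\ge1}\frac{\#X(\mathbb{F}_{q^m})}{m}t^m$ and $\sum_{m\ge1}\frac{\#Y(\mathbb{F}_{q^m})}{m}t^m$ converge, $\log Z(Y,\cdot)$ is differentiable at $t$, and the series defining the Hasse–Weil information loss $$\mathcal{I}_{HW}(f^*)=\sum_{\gamma\in\mathcal{Z}^0_{\rm eff}(Y)}Q(\gamma)\log\frac{P(f^*\gamma)}{Q(\gamma)}$$ converges absolutely, with $$\mathcal{I}_{HW}(f^*)=\log\frac{Z(Y,t)}{Z(X,t)}+(\delta-1)\,t\log(t)\,\frac{d}{dt}\log Z(Y,t).$$ -/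

import Mathlib

open AlgebraicGeometry CategoryTheory

universe u

noncomputable section

namespace HasseWeil

/-- The extension of degree `m ≥ 1` of a finite field `k` with `q` elements: the splitting field
of `T ^ (q ^ m) - T` over `k`. -/
abbrev Ext (k : Type u) [Field k] (m : ℕ) : Type u :=
  (Polynomial.X ^ (Nat.card k ^ m) - Polynomial.X : Polynomial k).SplittingField

/-- The number of `𝔽_{q^m}`-points of `X` over `k = 𝔽_q`, for `m ≥ 1`, where `p` is the structure
morphism of `X`. -/
def numPoints {k : Type u} [Field k] {X : Scheme.{u}} (p : X ⟶ Spec (.of k)) (m : ℕ) : ℕ :=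
  Nat.card {g : Spec (.of (Ext k m)) ⟶ X //
    g ≫ p = Spec.map (CommRingCat.ofHom (algebraMap k (Ext k m)))}

/-- The terms `#X(𝔽_{q^m}) / m * t ^ m`, `m = n + 1 ≥ 1`, of the logarithm of the zeta function. -/
def logZetaTerm {k : Type u} [Field k] {X : Scheme.{u}} (p : X ⟶ Spec (.of k)) (t : ℝ) (n : ℕ) :
    ℝ :=
  (numPoints p (n + 1) : ℝ) / ((n + 1 : ℕ) : ℝ) * t ^ (n + 1)

/-- The Hasse--Weil zeta function `Z(X, t) = exp (∑_{m ≥ 1} #X(𝔽_{q^m}) / m * t ^ m)`. -/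
def zeta {k : Type u} [Field k] {X : Scheme.{u}} (p : X ⟶ Spec (.of k)) (t : ℝ) : ℝ :=
  Real.exp (∑' n : ℕ, logZetaTerm p t n)

/-- Effective zero-cycles: formal finite sums of closed points with coefficients in `ℕ`. -/
abbrev ZeroCycle (X : Scheme.{u}) : Type u := closedPoints X →₀ ℕ

/-- The degree `∑ nᵢ [κ(xᵢ) : k]` of the zero-cycle `∑ nᵢ xᵢ`. Here `p.residueDegree x` is the
degree of `κ(x)` over the residue field of the unique point of `Spec k`, which is `k`. -/
def cycleDegree {k : Type u} [Field k] {X : Scheme.{u}} (p : X ⟶ Spec (.of k))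
    (α : ZeroCycle X) : ℕ :=
  α.sum fun x n => n * p.residueDegree x.1

/-- The distribution `α ↦ t ^ deg α / Z(X, t)` on effective zero-cycles. -/
def cycleDist {k : Type u} [Field k] {X : Scheme.{u}} (p : X ⟶ Spec (.of k)) (t : ℝ)
    (α : ZeroCycle X) : ℝ :=
  t ^ cycleDegree p α / zeta p t

/-- The multiplicity of `x` in the scheme-theoretic fibre of `f` through `x`: the length of
the local ring `𝒪_{X,x} / 𝔪_{f(x)} 𝒪_{X,x}` of that fibre at `x`. -/
def fibreMult {X Y : Scheme.{u}} (f : X ⟶ Y) (x : X) : ℕ :=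
  (Module.length (X.presheaf.stalk x)
    (X.presheaf.stalk x ⧸
      (IsLocalRing.maximalIdeal (Y.presheaf.stalk (f x))).map (f.stalkMap x).hom)).toNat

/-- A finite morphism maps closed points to closed points. -/
def mapClosed {X Y : Scheme.{u}} (f : X ⟶ Y) [IsFinite f] (x : closedPoints X) :
    closedPoints Y :=
  ⟨f x.1, by
    have h := f.isClosedMap {x.1} x.2
    rw [Set.image_singleton] at h
    exact h⟩

/-- The coefficients of the cycle `∑ nᵢ [f⁻¹(yᵢ)]`, for `γ = ∑ nᵢ yᵢ`. -/
def pullbackCoeff {X Y : Scheme.{u}} (f : X ⟶ Y) [IsFinite f] (γ : ZeroCycle Y)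
    (x : closedPoints X) : ℕ :=
  γ (mapClosed f x) * fibreMult f x.1

theorem finite_support_pullbackCoeff {X Y : Scheme.{u}} (f : X ⟶ Y) [IsFinite f]
    (γ : ZeroCycle Y) : (Function.support (pullbackCoeff f γ)).Finite := by
  have h : ((f : X → Y) ⁻¹' (Subtype.val '' (γ.support : Set (closedPoints Y)))).Finite :=
    f.finite_preimage (γ.support.finite_toSet.image _)
  refine (h.preimage (Subtype.val_injective (p := (· ∈ closedPoints X))).injOn).subset ?_
  intro x hx
  refine ⟨mapClosed f x, ?_, rfl⟩
  simp only [Finset.mem_coe, Finsupp.mem_support_iff]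
  intro h0
  exact hx (by simp [pullbackCoeff, h0])

/-- The pullback `f^*(∑ nᵢ yᵢ) = ∑ nᵢ [f⁻¹(yᵢ)]` of effective zero-cycles along a (flat) finite
morphism, where `[f⁻¹(y)]` is the zero-cycle of the scheme-theoretic fibre. -/
def pullbackCycle {X Y : Scheme.{u}} (f : X ⟶ Y) [IsFinite f] (γ : ZeroCycle Y) : ZeroCycle X :=
  Finsupp.ofSupportFinite (pullbackCoeff f γ) (finite_support_pullbackCoeff f γ)

/-- The terms `Q(γ) * log (P(f^* γ) / Q(γ))` of the information loss, where `P` and `Q` are the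
distributions on effective zero-cycles of `X` and of `Y`. -/
def infoLossTerm {k : Type u} [Field k] {X Y : Scheme.{u}} (pX : X ⟶ Spec (.of k))
    (pY : Y ⟶ Spec (.of k)) (f : X ⟶ Y) [IsFinite f] (t : ℝ) (γ : ZeroCycle Y) : ℝ :=
  cycleDist pY t γ * Real.log (cycleDist pX t (pullbackCycle f γ) / cycleDist pY t γ)

/-- The Hasse--Weil information loss of a finite flat morphism `f : X ⟶ Y`. -/
def infoLoss {k : Type u} [Field k] {X Y : Scheme.{u}} (pX : X ⟶ Spec (.of k))
    (pY : Y ⟶ Spec (.of k)) (f : X ⟶ Y) [IsFinite f] (t : ℝ) : ℝ :=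
  ∑' γ : ZeroCycle Y, infoLossTerm pX pY f t γ

end HasseWeil

end

/-!
Let `N m` be the number of points of `Y` over the extension of degree `m` of `k`.

* Such a point is a closed point `y` with an embedding of `κ(y)` into the extension, so `N m` is the
  sum of the `deg y` dividing `m` (`hasSum_numPoints`). Regrouping
  `-log (1 - t ^ deg y) = ∑ t ^ (r deg y) / r` by `m = r deg y` turns the logarithmic zeta series
  into the logarithm of an Euler product over closed points, and expanding that product gives
  `Z(Y, t) = ∑ t ^ deg γ` over all effective zero-cycles `γ` (`hasSum_pow_cycleDegree`).
* By Noether normalization `Y`, and any scheme finite over it, has `O(q ^ (d m))` points over the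
  extension of degree `m` (`exists_card_points_le`). Hence everything converges for `t < q ^ (-d)`,
  with room to differentiate `∑ t ^ deg γ` termwise (`hasDerivAt_log_zeta`).
* The scheme-theoretic fibre of `f` over any point has degree `δ`
  (`finsum_fibreMult_mul_residueDegree`): for affine schemes this is the sum formula for
  ramification indices and inertia degrees. Hence `deg (f^* γ) = δ deg γ`
  (`cycleDegree_pullbackCycle`).

Consequently `log (P(f^* γ) / Q(γ)) = log (Z(Y, t) / Z(X, t)) + (δ - 1) deg γ log t`
(`infoLossTerm_eq`). The mean of this quantity for the distribution `Q` is the assertion: `Q` has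
total mass `1`, and the mean of `deg γ` is `t Z'(Y, t) / Z(Y, t)`.
-/

namespace HasseWeil

/-! ### Euler products over finitely supported functions -/

section EulerProduct

variable {ι : Type*}

/-- The partial Euler product over a finite set `S` is the sum over the cycles supported on `S`. -/
theorem hasSum_prod_pow_support_subset (u : ι → ℝ) (h0 : ∀ x, 0 ≤ u x) (h1 : ∀ x, u x < 1)
    (S : Finset ι) :
    HasSum (fun γ : {γ : ι →₀ ℕ // γ.support ⊆ S} => γ.1.prod fun x n => u x ^ n)
      (∏ x ∈ S, (1 - u x)⁻¹) := by
  classical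
  induction S using Finset.induction_on with
  | empty =>
    have : Unique {γ : ι →₀ ℕ // γ.support ⊆ ∅} :=
      ⟨⟨⟨0, by simp⟩⟩, fun γ => Subtype.ext (by simpa using γ.2)⟩
    have h0 : (default : {γ : ι →₀ ℕ // γ.support ⊆ ∅}).1 = 0 := by
      have := (default : {γ : ι →₀ ℕ // γ.support ⊆ ∅}).2
      simpa using this
    have h := hasSum_unique fun γ : {γ : ι →₀ ℕ // γ.support ⊆ ∅} => γ.1.prod fun x n => u x ^ n
    simpa [h0] using h
  | insert a S ha ih =>
    -- A cycle supported on `insert a S` is its coefficient at `a` and a cycle supported on `S`.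
    let e : ℕ × {γ : ι →₀ ℕ // γ.support ⊆ S} ≃ {γ : ι →₀ ℕ // γ.support ⊆ insert a S} :=
      { toFun := fun p => ⟨p.2.1.update a p.1, by
          intro x hx
          by_cases hxa : x = a
          · simp [hxa]
          · refine Finset.mem_insert_of_mem (p.2.2 ?_)
            simpa [hxa] using hx⟩
        invFun := fun γ => ⟨γ.1 a, γ.1.erase a, by
          rw [Finsupp.support_erase, ← Finset.subset_insert_iff]
          exact γ.2⟩
        left_inv := fun p => by
          have : p.2.1 a = 0 := Finsupp.notMem_support_iff.1 fun h => ha (p.2.2 h)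
          refine Prod.ext (by simp) (Subtype.ext ?_)
          ext x
          by_cases hx : x = a
          · subst hx; simp [this]
          · simp [hx]
        right_inv := fun γ => by
          refine Subtype.ext ?_
          ext x
          by_cases hx : x = a
          · subst hx; simp
          · simp }
    rw [← e.hasSum_iff, Finset.prod_insert ha]
    have hg := hasSum_geometric_of_lt_one (h0 a) (h1 a)
    have key : ((fun γ : {γ : ι →₀ ℕ // γ.support ⊆ insert a S} =>
        γ.1.prod fun x n => u x ^ n) ∘ e) =
        fun p => u a ^ p.1 * p.2.1.prod fun x n => u x ^ n := by
      funext p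
      have h0 : p.2.1 a = 0 := Finsupp.notMem_support_iff.1 fun h => ha (p.2.2 h)
      have h2 : (e p).1 = Finsupp.single a p.1 + p.2.1 := by
        ext x
        by_cases hx : x = a
        · subst hx; simp [e, h0]
        · simp [e, hx]
      simp only [Function.comp_apply]
      rw [h2, Finsupp.prod_add_index' (by simp) (fun _ _ _ => pow_add _ _ _),
        Finsupp.prod_single_index (by simp)]
    rw [key]
    have hs := hg.summable.mul_of_nonneg ih.summable (fun n => pow_nonneg (h0 a) n)
      (fun γ => Finset.prod_nonneg fun x _ => pow_nonneg (h0 x) _)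
    exact hg.mul ih hs

/-- The Euler product: if `∑ -log (1 - u x)` converges then the sum of the monomials in the `u x`
is the exponential of its value. The partial products are sums over the cycles supported on a
finite set, and these exhaust all cycles. -/
theorem hasSum_prod_pow_of_hasSum_log (u : ι → ℝ) (h0 : ∀ x, 0 ≤ u x) (h1 : ∀ x, u x < 1)
    {ℓ : ℝ} (hℓ : HasSum (fun x => -Real.log (1 - u x)) ℓ) :
    HasSum (fun γ : ι →₀ ℕ => γ.prod fun x n => u x ^ n) (Real.exp ℓ) := by
  classical
  have hnn (γ : ι →₀ ℕ) : 0 ≤ γ.prod fun x n => u x ^ n :=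
    Finset.prod_nonneg fun x _ => pow_nonneg (h0 x) _
  have hexp (S : Finset ι) : ∏ x ∈ S, (1 - u x)⁻¹ = Real.exp (∑ x ∈ S, -Real.log (1 - u x)) := by
    rw [Real.exp_sum]
    refine Finset.prod_congr rfl fun x _ => ?_
    rw [Real.exp_neg, Real.exp_log (by linarith [h1 x])]
  have hlog (x : ι) : 0 ≤ -Real.log (1 - u x) := by
    rw [neg_nonneg]
    exact Real.log_nonpos (by linarith [h1 x]) (by linarith [h0 x])
  refine hasSum_of_isLUB_of_nonneg _ hnn ⟨?_, ?_⟩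
  · rintro _ ⟨F, rfl⟩
    let S : Finset ι := F.biUnion Finsupp.support
    have hS (γ : F) : γ.1.support ⊆ S := Finset.subset_biUnion_of_mem Finsupp.support γ.2
    have h := hasSum_prod_pow_support_subset u h0 h1 S
    have h2 : ∑ γ ∈ F, (γ.prod fun x n => u x ^ n) ≤ ∏ x ∈ S, (1 - u x)⁻¹ := by
      rw [← Finset.sum_coe_sort F]
      have := h.summable.sum_le_tsum (Finset.univ.map
        ⟨fun γ : F => (⟨γ.1, hS γ⟩ : {γ : ι →₀ ℕ // γ.support ⊆ S}),
          fun a b hab => Subtype.ext (congrArg (fun z => z.1) hab)⟩) (fun γ _ => hnn γ.1)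
      rw [h.tsum_eq, Finset.sum_map] at this
      exact this
    refine h2.trans ?_
    rw [hexp]
    exact Real.exp_le_exp.2 (sum_le_hasSum S (fun x _ => hlog x) hℓ)
  · intro b hb
    have hS (S : Finset ι) : Real.exp (∑ x ∈ S, -Real.log (1 - u x)) ≤ b := by
      rw [← hexp, ← (hasSum_prod_pow_support_subset u h0 h1 S).tsum_eq]
      refine Real.tsum_le_of_sum_le (fun γ => hnn γ.1) fun F => ?_
      refine le_trans (le_of_eq ?_) (hb ⟨F.map (Function.Embedding.subtype _), rfl⟩)
      simp
    exact le_of_tendsto ((Real.continuous_exp.tendsto ℓ).comp hℓ) (Filter.Eventually.of_forall hS)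

/-- Regrouping `∑ₓ -log (1 - t ^ deg x) = ∑ₓ ∑ᵣ t ^ (r * deg x) / r` by the exponent
`m = r * deg x`: the coefficient of `t ^ m / m` is the sum of the `deg x` dividing `m`. -/
theorem hasSum_neg_log_one_sub_pow (deg : ι → ℕ) (hdeg : ∀ x, 0 < deg x) (N : ℕ → ℕ)
    (hN : ∀ n, HasSum (fun x => if deg x ∣ n + 1 then (deg x : ℝ) else 0) (N (n + 1)))
    {t : ℝ} (ht0 : 0 ≤ t) (ht1 : t < 1)
    (hs : Summable fun n => (N (n + 1) : ℝ) / ((n + 1 : ℕ) : ℝ) * t ^ (n + 1)) :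
    HasSum (fun x => -Real.log (1 - t ^ deg x))
      (∑' n, (N (n + 1) : ℝ) / ((n + 1 : ℕ) : ℝ) * t ^ (n + 1)) := by
  let F : ℕ × ι → ℝ := fun p =>
    (if deg p.2 ∣ p.1 + 1 then (deg p.2 : ℝ) else 0) * (t ^ (p.1 + 1) / ((p.1 + 1 : ℕ) : ℝ))
  have hF0 : 0 ≤ F := fun p => mul_nonneg (by positivity) (by positivity)
  have hrow (n : ℕ) : HasSum (fun x => F (n, x))
      ((N (n + 1) : ℝ) / ((n + 1 : ℕ) : ℝ) * t ^ (n + 1)) := by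
    rw [div_mul_eq_mul_div, mul_div_assoc]
    exact (hN n).mul_right _
  have hcol (x : ι) : HasSum (fun n => F (n, x)) (-Real.log (1 - t ^ deg x)) := by
    have hx := hdeg x
    have h := Real.hasSum_pow_div_log_of_abs_lt_one (x := t ^ deg x) (by
      rw [abs_of_nonneg (by positivity)]
      exact pow_lt_one₀ ht0 ht1 hx.ne')
    -- Only the multiples of `deg x` contribute; index them by `g`, shifted as sums start at `0`.
    let g : ℕ → ℕ := fun r => (r + 1) * deg x - 1
    have hg1 (r : ℕ) : g r + 1 = (r + 1) * deg x := Nat.succ_pred_eq_of_pos (Nat.mul_pos r.succ_pos hx)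
    have hg : Function.Injective g := fun r s hrs => by
      have : (r + 1) * deg x = (s + 1) * deg x := by rw [← hg1, ← hg1, hrs]
      exact Nat.succ_injective (Nat.eq_of_mul_eq_mul_right hx this)
    rw [← hg.hasSum_iff]
    · convert h using 2 with r
      have hx' : (deg x : ℝ) ≠ 0 := by positivity
      simp only [F, Function.comp_apply, hg1, dvd_mul_left, if_true, Nat.cast_mul]
      rw [mul_comm (r + 1) (deg x), pow_mul]
      push_cast
      field_simp
    · intro n hn
      have : ¬ deg x ∣ n + 1 := by
        rintro ⟨r, hr⟩
        refine hn ⟨r - 1, ?_⟩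
        have hr0 : r ≠ 0 := by rintro rfl; simp at hr
        have := hg1 (r - 1)
        rw [Nat.sub_add_cancel (Nat.pos_of_ne_zero hr0), mul_comm, ← hr] at this
        exact Nat.succ_injective this
      simp [F, this]
  have hsum : Summable F := by
    rw [summable_prod_of_nonneg hF0]
    exact ⟨fun n => (hrow n).summable, by simpa only [(hrow _).tsum_eq] using hs⟩
  have h1 : HasSum F (∑' n, (N (n + 1) : ℝ) / ((n + 1 : ℕ) : ℝ) * t ^ (n + 1)) := by
    rw [(hsum.hasSum.prod_fiberwise hrow).tsum_eq]
    exact hsum.hasSum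
  exact ((Equiv.prodComm ι ℕ).hasSum_iff.2 h1).prod_fiberwise hcol

theorem summable_div_mul_pow (N : ℕ → ℕ) (C Q : ℝ) (hQ : 0 ≤ Q)
    (hb : ∀ n, (N (n + 1) : ℝ) ≤ C * Q ^ (n + 1)) {t : ℝ} (ht0 : 0 ≤ t) (ht : t * Q < 1) :
    Summable fun n => (N (n + 1) : ℝ) / ((n + 1 : ℕ) : ℝ) * t ^ (n + 1) := by
  refine Summable.of_nonneg_of_le (fun n => by positivity) (fun n => ?_)
    (((summable_geometric_of_lt_one (by positivity) ht).mul_left (t * Q)).mul_left C)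
  have h1 : (N (n + 1) : ℝ) / ((n + 1 : ℕ) : ℝ) ≤ N (n + 1) :=
    div_le_self (by positivity) (by simp)
  calc (N (n + 1) : ℝ) / ((n + 1 : ℕ) : ℝ) * t ^ (n + 1)
      ≤ (C * Q ^ (n + 1)) * t ^ (n + 1) := by gcongr; exact h1.trans (hb n)
    _ = C * (t * Q * (t * Q) ^ n) := by rw [← pow_succ', mul_pow]; ring

/-- The sum of `t ^ deg γ` over all effective cycles `γ` is the exponential of the logarithmic
zeta series. -/
theorem hasSum_pow_degree (deg : ι → ℕ) (hdeg : ∀ x, 0 < deg x) (N : ℕ → ℕ)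
    (hN : ∀ n, HasSum (fun x => if deg x ∣ n + 1 then (deg x : ℝ) else 0) (N (n + 1)))
    {t : ℝ} (ht0 : 0 ≤ t) (ht1 : t < 1)
    (hs : Summable fun n => (N (n + 1) : ℝ) / ((n + 1 : ℕ) : ℝ) * t ^ (n + 1)) :
    HasSum (fun γ : ι →₀ ℕ => t ^ (γ.sum fun x n => n * deg x))
      (Real.exp (∑' n, (N (n + 1) : ℝ) / ((n + 1 : ℕ) : ℝ) * t ^ (n + 1))) := by
  have h := hasSum_prod_pow_of_hasSum_log (fun x => t ^ deg x) (fun x => by positivity)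
    (fun x => pow_lt_one₀ ht0 ht1 (hdeg x).ne')
    (hasSum_neg_log_one_sub_pow deg hdeg N hN ht0 ht1 hs)
  convert h using 2 with γ
  rw [Finsupp.sum, ← Finset.prod_pow_eq_pow_sum, Finsupp.prod]
  refine Finset.prod_congr rfl fun x _ => ?_
  rw [← pow_mul, mul_comm]

end EulerProduct

/-! ### Termwise differentiation -/

section Deriv

variable {κ : Type*}

theorem exists_mul_pow_le {r s : ℝ} (hr : 0 ≤ r) (hrs : r < s) :
    ∃ K : ℝ, ∀ n : ℕ, n * r ^ n ≤ K * s ^ n := by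
  have hs : 0 < s := hr.trans_lt hrs
  have h := tendsto_self_mul_const_pow_of_lt_one (r := r / s) (by positivity)
    ((div_lt_one hs).2 hrs)
  obtain ⟨K, hK⟩ := h.bddAbove_range
  refine ⟨K, fun n => ?_⟩
  have := hK ⟨n, rfl⟩
  simp only [div_pow] at this
  rwa [← mul_div_assoc, div_le_iff₀ (by positivity)] at this

theorem summable_mul_pow (D : κ → ℕ) {r s : ℝ} (hr : 0 ≤ r) (hrs : r < s)
    (hs : Summable fun γ => s ^ D γ) : Summable fun γ => (D γ : ℝ) * r ^ D γ := by
  obtain ⟨K, hK⟩ := exists_mul_pow_le hr hrs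
  exact Summable.of_nonneg_of_le (fun γ => by positivity) (fun γ => hK (D γ)) (hs.mul_left K)

theorem hasDerivAt_tsum_pow (D : κ → ℕ) {t s : ℝ} (ht : 0 < t) (hts : t < s)
    (hs : Summable fun γ => s ^ D γ) :
    HasDerivAt (fun r : ℝ => ∑' γ, r ^ D γ) (∑' γ, (D γ : ℝ) * t ^ (D γ - 1)) t := by
  obtain ⟨r, htr, hrs⟩ := exists_between hts
  have hr : 0 < r := ht.trans htr
  have hsum := summable_mul_pow D hr.le hrs hs
  refine hasDerivAt_tsum_of_isPreconnected (u := fun γ => r⁻¹ * ((D γ : ℝ) * r ^ D γ))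
    (t := Set.Ioo 0 r) (y₀ := t)
    (hsum.mul_left _) isOpen_Ioo isPreconnected_Ioo (fun γ y _ => hasDerivAt_pow (D γ) y)
    (fun γ y hy => ?_) ⟨ht, htr⟩ ?_ ⟨ht, htr⟩
  · rw [Real.norm_of_nonneg (by have := hy.1; positivity)]
    rcases Nat.eq_zero_or_pos (D γ) with h | h
    · simp [h]
    · have : r⁻¹ * ((D γ : ℝ) * r ^ D γ) = D γ * r ^ (D γ - 1) := by
        obtain ⟨n, hn⟩ := Nat.exists_eq_succ_of_ne_zero h.ne'
        rw [hn]
        simp only [Nat.succ_eq_add_one, Nat.add_sub_cancel, pow_succ]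
        field_simp
      rw [this]
      have h1 := hy.1.le
      have h2 := hy.2.le
      gcongr
  · exact Summable.of_nonneg_of_le (fun γ => by positivity)
      (fun γ => pow_le_pow_left₀ ht.le hts.le _) hs

end Deriv

/-! ### Points of finite algebras over polynomial rings -/

section AlgHomBound

/-- By linear independence of characters, an algebra spanned by `n` elements as a module has at
most `n` homomorphisms to a field. -/
theorem card_algHom_le_of_span {R B F : Type*} [CommRing R] [CommRing B] [Algebra R B] [Field F]
    [Algebra R F] {n : ℕ} (b : Fin n → B) (hb : Submodule.span R (Set.range b) = ⊤) :
    Finite (B →ₐ[R] F) ∧ Nat.card (B →ₐ[R] F) ≤ n := by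
  -- A module homomorphism is determined by its values on the spanning family.
  let ev : (B →ₗ[R] F) →ₗ[F] (Fin n → F) :=
    { toFun := fun φ i => φ (b i)
      map_add' := fun _ _ => rfl
      map_smul' := fun _ _ => rfl }
  have hev : LinearMap.ker ev = ⊥ := by
    refine LinearMap.ker_eq_bot'.2 fun φ hφ => LinearMap.ext_on hb ?_
    rintro _ ⟨i, rfl⟩
    exact congrFun hφ i
  have h := (linearIndependent_toLinearMap R B F).map' ev hev
  have hfin : Finite (B →ₐ[R] F) := h.finite
  have := Fintype.ofFinite (B →ₐ[R] F)
  refine ⟨hfin, ?_⟩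
  rw [Nat.card_eq_fintype_card]
  simpa using h.fintype_card_le_finrank

/-- A finite algebra over a polynomial ring in `r` variables has `O(#F ^ r)` points over `F`: there
are `#F ^ r` points of affine space, and boundedly many points above each of them. -/
theorem exists_card_algHom_le {k : Type*} [Field k] {r : ℕ} {B : Type*} [CommRing B] [Algebra k B]
    [Algebra (MvPolynomial (Fin r) k) B] [IsScalarTower k (MvPolynomial (Fin r) k) B]
    [Module.Finite (MvPolynomial (Fin r) k) B] :
    ∃ C : ℕ, ∀ (F : Type u) [Field F] [Finite F] [Algebra k F],
      Finite (B →ₐ[k] F) ∧ Nat.card (B →ₐ[k] F) ≤ C * Nat.card F ^ r := by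
  obtain ⟨n, b, hb⟩ := Module.Finite.exists_fin (R := MvPolynomial (Fin r) k) (M := B)
  refine ⟨n, fun F _ _ _ => ?_⟩
  let R := MvPolynomial (Fin r) k
  -- `A φ` is the set of points lying over the point `φ` of affine space.
  let A : (R →ₐ[k] F) → Type _ := fun φ => letI := φ.toRingHom.toAlgebra; B →ₐ[R] F
  let e : (B →ₐ[k] F) → Σ φ : R →ₐ[k] F, A φ := fun ψ =>
    ⟨ψ.comp (IsScalarTower.toAlgHom k R B),
      letI := (ψ.comp (IsScalarTower.toAlgHom k R B)).toRingHom.toAlgebra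
      { ψ.toRingHom with commutes' := fun _ => rfl }⟩
  have he : Function.Injective e := by
    intro ψ₁ ψ₂ h
    have key : ∀ s : (Σ φ : R →ₐ[k] F, A φ), ∀ s', s = s' →
        (letI := s.1.toRingHom.toAlgebra; (s.2 : B → F)) =
          (letI := s'.1.toRingHom.toAlgebra; (s'.2 : B → F)) := by
      rintro s s' rfl; rfl
    exact DFunLike.coe_injective (key _ _ h)
  let v : (R →ₐ[k] F) → (Fin r → F) := fun φ i => φ (MvPolynomial.X i)
  have hv : Function.Injective v := fun _ _ h => MvPolynomial.algHom_ext (congrFun h)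
  have hRf : Finite (R →ₐ[k] F) := Finite.of_injective v hv
  have hA (φ : R →ₐ[k] F) : Finite (A φ) ∧ Nat.card (A φ) ≤ n :=
    letI := φ.toRingHom.toAlgebra
    card_algHom_le_of_span b hb
  have (φ : R →ₐ[k] F) : Finite (A φ) := (hA φ).1
  refine ⟨Finite.of_injective e he, (Nat.card_le_card_of_injective e he).trans ?_⟩
  have := Fintype.ofFinite (R →ₐ[k] F)
  rw [Nat.card_sigma]
  refine (Finset.sum_le_card_nsmul _ _ n fun φ _ => (hA φ).2).trans ?_
  rw [Finset.card_univ, ← Nat.card_eq_fintype_card, smul_eq_mul, mul_comm]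
  have h := Nat.card_le_card_of_injective v hv
  rw [Nat.card_fun, Nat.card_fin] at h
  gcongr

/-- Chains of primes lift along injective integral extensions, by lying over and going up. -/
theorem ringKrullDim_le_of_isIntegral {R S : Type*} [CommRing R] [CommRing S] [Algebra R S]
    [Algebra.IsIntegral R S] (h : Function.Injective (algebraMap R S)) :
    ringKrullDim R ≤ ringKrullDim S := by
  refine iSup_le fun l => ?_
  obtain ⟨P, -, hP, hPl⟩ := Ideal.exists_ideal_over_prime_of_isIntegral l.head.asIdeal (⊥ : Ideal S)
    (by rw [← RingHom.ker, (RingHom.injective_iff_ker_eq_bot _).1 h]; exact bot_le)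
  have : P.LiesOver l.head.asIdeal := ⟨hPl.symm⟩
  obtain ⟨L, hL, -⟩ := Ideal.exists_ltSeries_of_hasGoingUp l P
  rw [← hL]
  exact le_iSup (fun L : LTSeries (PrimeSpectrum S) => ((L.length : ℕ) : WithBot ℕ∞)) L

/-- Noether normalization bounds the number of points: if `A` has Krull dimension at most `d`,
then any finite `A`-algebra is finite over a polynomial ring in at most `d` variables. -/
theorem exists_card_algHom_le_of_ringKrullDim_le {k : Type*} [Field k] {A B : Type*} [CommRing A]
    [CommRing B] [Algebra k A] [Algebra k B] [Algebra A B] [IsScalarTower k A B]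
    [Algebra.FiniteType k A] [Module.Finite A B] {d : ℕ} (hd : ringKrullDim A ≤ d) :
    ∃ C : ℕ, ∀ (F : Type u) [Field F] [Finite F] [Algebra k F],
      Finite (B →ₐ[k] F) ∧ Nat.card (B →ₐ[k] F) ≤ C * Nat.card F ^ d := by
  cases subsingleton_or_nontrivial A with
  | inl hA =>
    have : Subsingleton B := (algebraMap A B).codomain_trivial
    refine ⟨0, fun F _ _ _ => ?_⟩
    have : IsEmpty (B →ₐ[k] F) := ⟨fun φ => one_ne_zero (α := F) (by
      rw [← map_one φ, Subsingleton.elim (1 : B) 0, map_zero])⟩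
    exact ⟨inferInstance, by simp⟩
  | inr hA =>
    obtain ⟨r, g, hg, hgf⟩ := exists_finite_inj_algHom_of_fg k A
    let : Algebra (MvPolynomial (Fin r) k) A := g.toRingHom.toAlgebra
    have : Module.Finite (MvPolynomial (Fin r) k) A := hgf
    let : Algebra (MvPolynomial (Fin r) k) B :=
      ((algebraMap A B).comp g.toRingHom).toAlgebra
    have : IsScalarTower (MvPolynomial (Fin r) k) A B := .of_algebraMap_eq fun _ => rfl
    have : IsScalarTower k (MvPolynomial (Fin r) k) B := .of_algebraMap_eq fun x => by
      change _ = algebraMap A B (g (algebraMap k _ x))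
      rw [g.commutes, ← IsScalarTower.algebraMap_apply]
    have : Module.Finite (MvPolynomial (Fin r) k) B := .trans A B
    have hr : r ≤ d := by
      have h := (ringKrullDim_le_of_isIntegral (R := MvPolynomial (Fin r) k) (S := A) hg).trans hd
      rw [MvPolynomial.ringKrullDim_of_isNoetherianRing, ringKrullDim_eq_zero_of_field] at h
      simpa using h
    obtain ⟨C, hC⟩ := exists_card_algHom_le (k := k) (r := r) (B := B)
    refine ⟨C, fun F _ _ _ => ⟨(hC F).1, (hC F).2.trans ?_⟩⟩
    gcongr
    exact Nat.card_pos

end AlgHomBound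

/-! ### Points over finite extensions and closed points -/

section Points

theorem finrank_ext {k : Type u} [Field k] [Finite k] {m : ℕ} (hm : m ≠ 0) :
    Module.finrank k (Ext k m) = m := by
  obtain ⟨p, hp⟩ := CharP.exists k
  have : Fact p.Prime := ⟨CharP.char_is_prime k p⟩
  have : NeZero m := ⟨hm⟩
  rw [← (Polynomial.IsSplittingField.algEquiv (FiniteField.Extension k p m)
    (Polynomial.X ^ (Nat.card k ^ m) - Polynomial.X : Polynomial k)).toLinearEquiv.finrank_eq]
  exact FiniteField.finrank_extension k p m

instance (k : Type u) [Field k] [Finite k] (m : ℕ) : Finite (Ext k m) :=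
  Module.finite_of_finite k

theorem natCard_ext {k : Type u} [Field k] [Finite k] {m : ℕ} (hm : m ≠ 0) :
    Nat.card (Ext k m) = Nat.card k ^ m := by
  rw [Module.natCard_eq_pow_finrank (K := k), finrank_ext hm]

/-- The structure morphism `k ⟶ κ(x)` of the residue field of a point of a scheme over `k`. -/
noncomputable def residueFieldBase {k : Type u} [Field k] {X : Scheme.{u}} (p : X ⟶ Spec (.of k))
    (x : X) : CommRingCat.of k ⟶ X.residueField x :=
  Spec.preimage (X.fromSpecResidueField x ≫ p)

/-- The `k`-algebra structure on the residue field of a point of a scheme over `k`. -/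
@[reducible] noncomputable def residueFieldAlgebra {k : Type u} [Field k] {X : Scheme.{u}}
    (p : X ⟶ Spec (.of k)) (x : X) : Algebra k (X.residueField x) :=
  (residueFieldBase p x).hom.toAlgebra

theorem bijective_preimage_fromSpecResidueField {R : CommRingCat.{u}} (hR : IsField R)
    (y : Spec R) : Function.Bijective (Spec.preimage ((Spec R).fromSpecResidueField y)).hom := by
  have hy : y.asIdeal.IsPrime := y.2
  have h : Spec.preimage ((Spec R).fromSpecResidueField y) =
      CommRingCat.ofHom (algebraMap R y.asIdeal.ResidueField) ≫
        (Scheme.Spec.residueFieldIso R y).inv := by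
    apply Spec.map_injective
    rw [Spec.map_preimage, Spec.map_comp]
    exact (Scheme.Spec.map_residueFieldIso_inv_eq_fromSpecResidueField R y).symm
  let := hR.toField
  rw [h, CommRingCat.hom_comp]
  have : y.asIdeal.IsMaximal := by
    have hy : y.asIdeal = ⊥ := (Ideal.eq_bot_or_top y.asIdeal).resolve_right y.2.ne_top
    rw [hy]
    exact Ideal.bot_isMaximal
  exact (ConcreteCategory.bijective_of_isIso (Scheme.Spec.residueFieldIso R y).inv).comp
    ⟨(algebraMap R y.asIdeal.ResidueField).injective, Ideal.algebraMap_residueField_surjective _⟩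

/-- The residue field of `Spec k` at its point is `k`. -/
theorem bijective_residueFieldBase_id {k : Type u} [Field k] (y : Spec (.of k)) :
    Function.Bijective (residueFieldBase (𝟙 (Spec (.of k))) y).hom := by
  rw [residueFieldBase, Category.comp_id]
  exact bijective_preimage_fromSpecResidueField (R := .of k) (Field.toIsField k) y

theorem residueFieldBase_eq {k : Type u} [Field k] {X : Scheme.{u}} (p : X ⟶ Spec (.of k)) (x : X) :
    residueFieldBase p x = residueFieldBase (𝟙 (Spec (.of k))) (p x) ≫ p.residueFieldMap x := by
  apply Spec.map_injective
  rw [residueFieldBase, residueFieldBase, Spec.map_preimage, Spec.map_comp, Spec.map_preimage,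
    Category.comp_id, Scheme.Hom.SpecMap_residueFieldMap_fromSpecResidueField]

theorem residueDegree_eq_finrank {k : Type u} [Field k] {X : Scheme.{u}} (p : X ⟶ Spec (.of k))
    (x : X) :
    p.residueDegree x = (letI := residueFieldAlgebra p x; Module.finrank k (X.residueField x)) := by
  let := residueFieldAlgebra p x
  let := (p.residueFieldMap x).hom.toAlgebra
  refine (Algebra.finrank_eq_of_equiv_equiv
    (RingEquiv.ofBijective _ (bijective_residueFieldBase_id (p x))) (RingEquiv.refl _) ?_).symm
  ext a
  exact (congrArg (fun φ => φ.hom a) (residueFieldBase_eq p x)).symm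

theorem finite_residueField {k : Type u} [Field k] {X : Scheme.{u}} (p : X ⟶ Spec (.of k))
    [LocallyOfFiniteType p] {x : X} (hx : IsClosed {x}) :
    letI := residueFieldAlgebra p x
    Module.Finite k (X.residueField x) := by
  have := isClosed_singleton_iff_isClosedImmersion.mp hx
  have h : IsFinite (X.fromSpecResidueField x ≫ p) := by
    rw [isFinite_iff_locallyOfFiniteType_of_jacobsonSpace]
    infer_instance
  rw [← Spec.map_preimage (X.fromSpecResidueField x ≫ p), IsFinite.SpecMap_iff] at h
  exact h

theorem residueDegree_pos {k : Type u} [Field k] {X : Scheme.{u}} (p : X ⟶ Spec (.of k))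
    [LocallyOfFiniteType p] {x : X} (hx : IsClosed {x}) : 0 < p.residueDegree x := by
  rw [residueDegree_eq_finrank]
  let := residueFieldAlgebra p x
  have := finite_residueField p hx
  exact Module.finrank_pos

/-- A point whose residue field embeds over `k` into a finite extension of `k` is closed. -/
theorem isClosed_singleton_of_algHom {k : Type u} [Field k] {X : Scheme.{u}} (p : X ⟶ Spec (.of k))
    [LocallyOfFiniteType p] (x : X) {F : Type u} [Field F] [Algebra k F] [Module.Finite k F]
    (φ : letI := residueFieldAlgebra p x; X.residueField x →ₐ[k] F) : IsClosed {x} := by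
  let := residueFieldAlgebra p x
  have : JacobsonSpace X := LocallyOfFiniteType.jacobsonSpace p
  have hfin : Module.Finite k (X.residueField x) :=
    Module.Finite.of_injective φ.toLinearMap φ.injective
  have h : IsFinite (X.fromSpecResidueField x ≫ p) := by
    rw [← Spec.map_preimage (X.fromSpecResidueField x ≫ p), IsFinite.SpecMap_iff]
    exact hfin
  rw [isClosed_singleton_iff_locallyOfFiniteType]
  exact locallyOfFiniteType_of_comp _ p

/-- A point of `X` with values in an extension `F` of `k` is a point `x` of `X` with an embedding
of `κ(x)` into `F` over `k`. -/
noncomputable def pointsEquivSigma {k : Type u} [Field k] {X : Scheme.{u}} (p : X ⟶ Spec (.of k))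
    (F : Type u) [Field F] [Algebra k F] :
    {g : Spec (.of F) ⟶ X // g ≫ p = Spec.map (CommRingCat.ofHom (algebraMap k F))} ≃
      Σ x : X, (letI := residueFieldAlgebra p x; X.residueField x →ₐ[k] F) :=
  have key (x : X) (φ : X.residueField x ⟶ .of F) :
      (Spec.map φ ≫ X.fromSpecResidueField x) ≫ p =
          Spec.map (CommRingCat.ofHom (algebraMap k F)) ↔
        φ.hom.comp (residueFieldBase p x).hom = algebraMap k F := by
    rw [Category.assoc, ← Spec.map_preimage (X.fromSpecResidueField x ≫ p), ← Spec.map_comp,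
      Spec.map_inj, CommRingCat.hom_ext_iff]
    rfl
  ((Scheme.SpecToEquivOfField F X).subtypeEquiv
      (q := fun s => s.2.hom.comp (residueFieldBase p s.1).hom = algebraMap k F) fun g => by
        rw [← key]
        conv_lhs => rw [← (Scheme.SpecToEquivOfField F X).symm_apply_apply g]
        rfl).trans
    { toFun := fun s => ⟨s.1.1, letI := residueFieldAlgebra p s.1.1
        { s.1.2.hom with commutes' := fun a => congrArg (fun ψ => ψ a) s.2 }⟩
      invFun := fun s => ⟨⟨s.1, CommRingCat.ofHom
        (letI := residueFieldAlgebra p s.1; s.2.toRingHom)⟩, by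
          let := residueFieldAlgebra p s.1
          ext a
          exact s.2.commutes a⟩
      left_inv := fun _ => rfl
      right_inv := fun _ => rfl }

theorem hasSum_natCard_of_finite_sigma {ι : Type*} (A : ι → Type*) [Finite (Σ x, A x)] :
    HasSum (fun x => (Nat.card (A x) : ℝ)) (Nat.card (Σ x, A x) : ℝ) := by
  have := Fintype.ofFinite (Σ x, A x)
  have h := hasSum_fintype (fun _ : Σ x, A x => (1 : ℝ))
  have hA (x : ι) : Finite (A x) := Finite.of_injective (Sigma.mk x) sigma_mk_injective
  simp only [Finset.sum_const, Finset.card_univ, nsmul_eq_mul, mul_one,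
    ← Nat.card_eq_fintype_card] at h
  refine h.sigma fun x => ?_
  have := Fintype.ofFinite (A x)
  simpa [Nat.card_eq_fintype_card] using hasSum_fintype (fun _ : A x => (1 : ℝ))

/-- The number of points over the extension of degree `m` is the sum of the degrees of the closed
points whose degree divides `m`: a closed point of degree `n` has residue field the extension of
degree `n`, which has `n` embeddings into the one of degree `m` if `n` divides `m`, and none
otherwise. -/
theorem hasSum_numPoints {k : Type u} [Field k] [Finite k] {X : Scheme.{u}} (p : X ⟶ Spec (.of k))
    [LocallyOfFiniteType p] {m : ℕ} (hm : m ≠ 0)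
    [hfin : Finite {g : Spec (.of (Ext k m)) ⟶ X //
      g ≫ p = Spec.map (CommRingCat.ofHom (algebraMap k (Ext k m)))}] :
    HasSum (fun x : closedPoints X =>
      if p.residueDegree x.1 ∣ m then (p.residueDegree x.1 : ℝ) else 0) (numPoints p m) := by
  let A : X → Type u := fun x => letI := residueFieldAlgebra p x; X.residueField x →ₐ[k] Ext k m
  have e := pointsEquivSigma p (Ext k m)
  have : Finite (Σ x : X, A x) := Finite.of_equiv _ e
  have h := hasSum_natCard_of_finite_sigma A
  have hcard : numPoints p m = Nat.card (Σ x : X, A x) := Nat.card_congr e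
  rw [← hcard, ← (Subtype.val_injective (p := (· ∈ closedPoints X))).hasSum_iff] at h
  · convert h using 2 with x
    rw [Function.comp_apply, residueDegree_eq_finrank]
    let := residueFieldAlgebra p x.1
    have := finite_residueField p x.2
    split_ifs with hd
    · rw [FiniteField.natCard_algHom_of_finrank_dvd (by rwa [finrank_ext hm])]
    · have : IsEmpty (X.residueField x.1 →ₐ[k] Ext k m) := ⟨fun φ => hd <| by
        rw [← finrank_ext (k := k) hm]
        exact FiniteField.nonempty_algHom_iff_finrank_dvd.1 ⟨φ⟩⟩
      simp [A]
  · intro x hx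
    have : IsEmpty (A x) := ⟨fun φ => hx ⟨⟨x, isClosed_singleton_of_algHom p x φ⟩, rfl⟩⟩
    simp

end Points

/-! ### Bounding the number of points -/

section PointBound

/-- Points of a finite scheme over an affine open `V` of `Y` are homomorphisms out of a finite
algebra over the coordinate ring of `V`. -/
theorem exists_card_points_mem_le {k : Type u} [Field k] {X Y : Scheme.{u}}
    (pY : Y ⟶ Spec (.of k)) [LocallyOfFiniteType pY] (f : X ⟶ Y) [IsFinite f] {d : ℕ}
    (hd : topologicalKrullDim Y ≤ d) {V : Y.Opens} (hV : IsAffineOpen V) :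
    ∃ C : ℕ, ∀ (F : Type u) [Field F] [Finite F] [Algebra k F],
      Finite {g : Spec (.of F) ⟶ X // g ≫ f ≫ pY =
          Spec.map (CommRingCat.ofHom (algebraMap k F)) ∧ ⊤ ≤ g ⁻¹ᵁ f ⁻¹ᵁ V} ∧
        Nat.card {g : Spec (.of F) ⟶ X // g ≫ f ≫ pY =
          Spec.map (CommRingCat.ofHom (algebraMap k F)) ∧ ⊤ ≤ g ⁻¹ᵁ f ⁻¹ᵁ V} ≤
        C * Nat.card F ^ d := by
  have hle : V ≤ pY ⁻¹ᵁ ⊤ := fun _ _ => trivial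
  let a : CommRingCat.of k ⟶ Γ(Y, V) := (Scheme.ΓSpecIso (.of k)).inv ≫ pY.appLE ⊤ V hle
  let b : Γ(Y, V) ⟶ Γ(X, f ⁻¹ᵁ V) := f.app V
  have ha : a.hom.FiniteType := by
    rw [CommRingCat.hom_comp]
    exact (pY.finiteType_appLE (isAffineOpen_top _) hV hle).comp
      (RingHom.FiniteType.of_surjective _
        (ConcreteCategory.bijective_of_isIso (Scheme.ΓSpecIso (.of k)).inv).surjective)
  have hb : b.hom.Finite := f.finite_app V hV
  let : Algebra k Γ(Y, V) := a.hom.toAlgebra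
  let : Algebra Γ(Y, V) Γ(X, f ⁻¹ᵁ V) := b.hom.toAlgebra
  let : Algebra k Γ(X, f ⁻¹ᵁ V) := (b.hom.comp a.hom).toAlgebra
  have : IsScalarTower k Γ(Y, V) Γ(X, f ⁻¹ᵁ V) := .of_algebraMap_eq fun _ => rfl
  have : Algebra.FiniteType k Γ(Y, V) := ha
  have : Module.Finite Γ(Y, V) Γ(X, f ⁻¹ᵁ V) := hb
  have hdim : ringKrullDim Γ(Y, V) ≤ d := by
    rw [← PrimeSpectrum.topologicalKrullDim_eq_ringKrullDim]
    exact (hV.fromSpec.isOpenEmbedding.isInducing.topologicalKrullDim_le).trans hd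
  obtain ⟨C, hC⟩ := exists_card_algHom_le_of_ringKrullDim_le.{u} (k := k) (A := Γ(Y, V))
    (B := Γ(X, f ⁻¹ᵁ V)) hdim
  refine ⟨C, fun F _ _ _ => ?_⟩
  have hU : IsAffineOpen (f ⁻¹ᵁ V) := hV.preimage f
  let e : {g : Spec (.of F) ⟶ X // g ≫ f ≫ pY =
      Spec.map (CommRingCat.ofHom (algebraMap k F)) ∧ ⊤ ≤ g ⁻¹ᵁ f ⁻¹ᵁ V} →
      (Γ(X, f ⁻¹ᵁ V) →ₐ[k] F) := fun g =>
    { (g.1.appLE (f ⁻¹ᵁ V) ⊤ g.2.2 ≫ (Scheme.ΓSpecIso (.of F)).hom).hom with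
      commutes' := fun x => by
        have h1 : a ≫ b ≫ g.1.appLE (f ⁻¹ᵁ V) ⊤ g.2.2 ≫ (Scheme.ΓSpecIso (.of F)).hom =
            CommRingCat.ofHom (algebraMap k F) := by
          have h2 : pY.appLE ⊤ V hle ≫ f.app V ≫ g.1.appLE (f ⁻¹ᵁ V) ⊤ g.2.2 =
              (Spec.map (CommRingCat.ofHom (algebraMap k F))).appTop := by
            rw [Scheme.Hom.app_eq_appLE, Scheme.Hom.appLE_comp_appLE,
              Scheme.Hom.appLE_comp_appLE]
            have key : ∀ {φ ψ : Spec (.of F) ⟶ Spec (.of k)} (_ : φ = ψ) (hφ : ⊤ ≤ φ ⁻¹ᵁ ⊤),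
                φ.appLE ⊤ ⊤ hφ = ψ.appTop := by
              rintro φ _ rfl hφ
              exact φ.appLE_eq_app
            exact key (by rw [Category.assoc]; exact g.2.1) _
          calc _ = (Scheme.ΓSpecIso (.of k)).inv ≫ (pY.appLE ⊤ V hle ≫ f.app V ≫
                g.1.appLE (f ⁻¹ᵁ V) ⊤ g.2.2) ≫ (Scheme.ΓSpecIso (.of F)).hom := by
                simp only [a, b, Category.assoc]
            _ = _ := by
                rw [h2, ← Category.assoc, ← Scheme.ΓSpecIso_inv_naturality, Category.assoc,
                  Iso.inv_hom_id, Category.comp_id]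
        exact congrArg (fun φ => φ.hom x) h1 }
  have he : Function.Injective e := by
    rintro ⟨g, hg, hgV⟩ ⟨g', hg', hgV'⟩ h
    have h1 : g.appLE (f ⁻¹ᵁ V) ⊤ hgV = g'.appLE (f ⁻¹ᵁ V) ⊤ hgV' := by
      rw [← cancel_mono (Scheme.ΓSpecIso (.of F)).hom]
      ext x
      exact DFunLike.congr_fun h x
    refine Subtype.ext ?_
    have h2 := IsAffineOpen.SpecMap_appLE_fromSpec g hU (isAffineOpen_top _) hgV
    rw [h1, IsAffineOpen.SpecMap_appLE_fromSpec g' hU (isAffineOpen_top _) hgV'] at h2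
    exact ((cancel_epi _).1 h2).symm
  have := (hC F).1
  exact ⟨Finite.of_injective e he, (Nat.card_le_card_of_injective e he).trans (hC F).2⟩

/-- A scheme that is finite over a scheme of finite type and of dimension at most `d` over `k`
has `O(#F ^ d)` points over the finite extensions `F` of `k`. -/
theorem exists_card_points_le {k : Type u} [Field k] {X Y : Scheme.{u}}
    (pY : Y ⟶ Spec (.of k)) [LocallyOfFiniteType pY] [QuasiCompact pY] (f : X ⟶ Y) [IsFinite f]
    {d : ℕ} (hd : topologicalKrullDim Y ≤ d) :
    ∃ C : ℕ, ∀ (F : Type u) [Field F] [Finite F] [Algebra k F],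
      Finite {g : Spec (.of F) ⟶ X // g ≫ f ≫ pY =
          Spec.map (CommRingCat.ofHom (algebraMap k F))} ∧
        Nat.card {g : Spec (.of F) ⟶ X // g ≫ f ≫ pY =
          Spec.map (CommRingCat.ofHom (algebraMap k F))} ≤ C * Nat.card F ^ d := by
  have : CompactSpace Y := QuasiCompact.compactSpace_of_compactSpace pY
  let 𝒰 := Y.affineCover.finiteSubcover
  have : Fintype 𝒰.I₀ := Fintype.ofFinite _
  have haff (i : 𝒰.I₀) : IsAffineOpen (𝒰.f i).opensRange := isAffineOpen_opensRange _
  choose C hC using fun i => exists_card_points_mem_le pY f hd (haff i)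
  refine ⟨∑ i, C i, fun F _ _ _ => ?_⟩
  let G : 𝒰.I₀ → Type u := fun i => {g : Spec (.of F) ⟶ X // g ≫ f ≫ pY =
    Spec.map (CommRingCat.ofHom (algebraMap k F)) ∧ ⊤ ≤ g ⁻¹ᵁ f ⁻¹ᵁ (𝒰.f i).opensRange}
  have hcov (g : Spec (.of F) ⟶ X) : ∃ i, ⊤ ≤ g ⁻¹ᵁ f ⁻¹ᵁ (𝒰.f i).opensRange := by
    refine ⟨𝒰.idx (f (g (IsLocalRing.closedPoint F))), fun y _ => ?_⟩
    rw [Subsingleton.elim y (IsLocalRing.closedPoint F)]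
    exact 𝒰.covers _
  choose i hi using hcov
  let e : {g : Spec (.of F) ⟶ X // g ≫ f ≫ pY =
      Spec.map (CommRingCat.ofHom (algebraMap k F))} → Σ i, G i :=
    fun g => ⟨i g.1, g.1, g.2, hi g.1⟩
  have he : Function.Injective e := fun g g' h => by
    have key : ∀ s s' : (Σ i, G i), s = s' → s.2.1 = s'.2.1 := by rintro s s' rfl; rfl
    exact Subtype.ext (key _ _ h)
  have (j : 𝒰.I₀) : Finite (G j) := (hC j F).1
  refine ⟨Finite.of_injective e he, (Nat.card_le_card_of_injective e he).trans ?_⟩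
  rw [Nat.card_sigma, Finset.sum_mul]
  exact Finset.sum_le_sum fun i _ => (hC i F).2

end PointBound

/-! ### Degrees of scheme-theoretic fibres -/

section Fibre

theorem length_quotient_map_ringEquiv {S S' : Type*} [CommRing S] [CommRing S'] (e : S ≃+* S')
    (I : Ideal S) (J : Ideal S') (hJ : J = I.map (e : S →+* S')) :
    Module.length S (S ⧸ I) = Module.length S' (S' ⧸ J) := by
  let : Algebra S S' := (e : S →+* S').toAlgebra
  let E : (S ⧸ I) ≃+* (S' ⧸ J) := Ideal.quotientEquiv I J e hJ
  let L : (S ⧸ I) ≃ₗ[S] (S' ⧸ J) :=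
    { E with
      map_smul' := fun s a => by
        obtain ⟨a, rfl⟩ := Ideal.Quotient.mk_surjective a
        change E (Ideal.Quotient.mk I (s * a)) = _
        rw [map_mul, map_mul]
        rfl }
  rw [L.length_eq]
  exact Module.length_eq_of_surjective (R := S') (S := S) e.surjective

/-- The multiplicity `length (S ⧸ 𝔪_R S)` depends only on the ring homomorphism up to
isomorphism. -/
theorem length_quotient_map_maximalIdeal {R R' S S' : Type*} [CommRing R] [CommRing R']
    [IsLocalRing R] [IsLocalRing R'] [CommRing S] [CommRing S'] (α : R →+* S) (α' : R' →+* S')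
    (eR : R ≃+* R') (eS : S ≃+* S')
    (h : α'.comp (eR : R →+* R') = (eS : S →+* S').comp α) :
    Module.length S (S ⧸ (IsLocalRing.maximalIdeal R).map α) =
      Module.length S' (S' ⧸ (IsLocalRing.maximalIdeal R').map α') := by
  refine length_quotient_map_ringEquiv eS _ _ ?_
  rw [Ideal.map_map, ← h, ← Ideal.map_map]
  congr 1
  have := Ideal.map_isMaximal_of_equiv eR (p := IsLocalRing.maximalIdeal R)
  exact (IsLocalRing.eq_maximalIdeal this).symm

theorem fibreMult_comp_left {X' X Y : Scheme.{u}} (i : X' ⟶ X) [IsOpenImmersion i] (f : X ⟶ Y)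
    (x : X') : fibreMult (i ≫ f) x = fibreMult f (i x) := by
  refine congrArg ENat.toNat (length_quotient_map_maximalIdeal (f.stalkMap (i x)).hom
    ((i ≫ f).stalkMap x).hom (RingEquiv.refl _)
    (asIso (i.stalkMap x)).commRingCatIsoToRingEquiv ?_).symm
  rw [Scheme.Hom.stalkMap_comp]
  rfl

theorem fibreMult_comp_right {X Y Y' : Scheme.{u}} (f : X ⟶ Y) (j : Y ⟶ Y') [IsOpenImmersion j]
    (x : X) : fibreMult (f ≫ j) x = fibreMult f x := by
  refine congrArg ENat.toNat (length_quotient_map_maximalIdeal ((f ≫ j).stalkMap x).hom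
    (f.stalkMap x).hom (asIso (j.stalkMap (f x))).commRingCatIsoToRingEquiv (RingEquiv.refl _) ?_)
  rw [Scheme.Hom.stalkMap_comp]
  rfl

theorem residueDegree_comp {X Y Z : Scheme.{u}} (f : X ⟶ Y) (g : Y ⟶ Z) (x : X) :
    (f ≫ g).residueDegree x = g.residueDegree (f x) * f.residueDegree x := by
  let a1 : Algebra (Z.residueField (g (f x))) (Y.residueField (f x)) :=
    (g.residueFieldMap (f x)).hom.toAlgebra
  let a2 : Algebra (Y.residueField (f x)) (X.residueField x) := (f.residueFieldMap x).hom.toAlgebra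
  let a3 : Algebra (Z.residueField (g (f x))) (X.residueField x) :=
    ((f ≫ g).residueFieldMap x).hom.toAlgebra
  have : IsScalarTower (Z.residueField (g (f x))) (Y.residueField (f x)) (X.residueField x) :=
    .of_algebraMap_eq fun a => by
      change ((f ≫ g).residueFieldMap x).hom a = _
      rw [Scheme.residueFieldMap_comp]
      rfl
  exact (Module.finrank_mul_finrank (Z.residueField (g (f x))) (Y.residueField (f x))
    (X.residueField x)).symm

theorem residueDegree_of_isOpenImmersion {X Y : Scheme.{u}} (f : X ⟶ Y) [IsOpenImmersion f]
    (x : X) : f.residueDegree x = 1 := by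
  let := (f.residueFieldMap x).hom.toAlgebra
  have h := Algebra.finrank_eq_of_equiv_equiv (R₀ := Y.residueField (f x)) (S₀ := X.residueField x)
    (R₁ := X.residueField x) (S₁ := X.residueField x)
    (asIso (f.residueFieldMap x)).commRingCatIsoToRingEquiv (RingEquiv.refl _) rfl
  exact h.trans (Module.finrank_self _)

section Spec

variable {R S : Type u} [CommRing R] [CommRing S] [Algebra R S]

theorem fibreMult_specMap (x : PrimeSpectrum S) :
    fibreMult (Spec.map (CommRingCat.ofHom (algebraMap R S))) x = x.asIdeal.ramificationIdx R := by
  let y := PrimeSpectrum.comap (algebraMap R S) x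
  rw [Ideal.ramificationIdx_def]
  have h : ((IsLocalRing.maximalIdeal (Localization.AtPrime y.asIdeal)).map
      (Localization.localRingHom y.asIdeal x.asIdeal (algebraMap R S) rfl)) =
      (x.asIdeal.under R).map (algebraMap R (Localization.AtPrime x.asIdeal)) := by
    rw [← Localization.AtPrime.map_eq_maximalIdeal, Ideal.map_map]
    change y.asIdeal.map _ = y.asIdeal.map _
    congr 1
    ext a
    exact (Localization.localRingHom_to_map y.asIdeal x.asIdeal (algebraMap R S) rfl a).trans
      (IsScalarTower.algebraMap_apply R S (Localization.AtPrime x.asIdeal) a).symm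
  rw [← h]
  refine congrArg ENat.toNat (length_quotient_map_maximalIdeal
    ((Spec.map (CommRingCat.ofHom (algebraMap R S))).stalkMap x).hom
    (Localization.localRingHom y.asIdeal x.asIdeal (algebraMap R S) rfl)
    (Spec.stalkIso (.of R) y).commRingCatIsoToRingEquiv
    (Spec.stalkIso (.of S) x).commRingCatIsoToRingEquiv ?_)
  have := Scheme.localRingHom_comp_stalkIso (CommRingCat.ofHom (algebraMap R S)) x
  ext a
  exact (Spec.stalkIso (.of S) x).commRingCatIsoToRingEquiv.symm_apply_eq.1
    (congrArg (fun φ => φ.hom a) this)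

theorem residueDegree_specMap (x : PrimeSpectrum S) :
    (Spec.map (CommRingCat.ofHom (algebraMap R S))).residueDegree x = x.asIdeal.inertiaDeg R := by
  let f := Spec.map (CommRingCat.ofHom (algebraMap R S))
  let y := PrimeSpectrum.comap (algebraMap R S) x
  let := Localization.AtPrime.algebraOfLiesOver (x.asIdeal.under R) x.asIdeal
  rw [Ideal.inertiaDeg_def]
  let := (f.residueFieldMap x).hom.toAlgebra
  let e₁ : (x.asIdeal.under R).ResidueField ≃+* (Spec (.of R)).residueField (f x) :=
    (Scheme.Spec.residueFieldIso (.of R) y).symm.commRingCatIsoToRingEquiv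
  let e₂ : x.asIdeal.ResidueField ≃+* (Spec (.of S)).residueField x :=
    (Scheme.Spec.residueFieldIso (.of S) x).symm.commRingCatIsoToRingEquiv
  have h₁ (a : R) : e₁ (algebraMap R _ a) =
      (Spec (.of R)).Γevaluation (f x) ((Scheme.ΓSpecIso (.of R)).inv a) :=
    congrArg (fun φ => φ.hom a) (Scheme.Spec.algebraMap_residueFieldIso_inv (.of R) y)
  have h₂ (a : S) : e₂ (algebraMap S _ a) =
      (Spec (.of S)).Γevaluation x ((Scheme.ΓSpecIso (.of S)).inv a) :=
    congrArg (fun φ => φ.hom a) (Scheme.Spec.algebraMap_residueFieldIso_inv (.of S) x)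
  refine (Algebra.finrank_eq_of_equiv_equiv e₁ e₂ ?_).symm
  refine Ideal.ResidueField.ringHom_ext ?_
  ext a
  have h₃ : f.appTop ((Scheme.ΓSpecIso (.of R)).inv a) =
      (Scheme.ΓSpecIso (.of S)).inv (algebraMap R S a) :=
    (congrArg (fun φ => φ.hom a)
      (Scheme.ΓSpecIso_inv_naturality (CommRingCat.ofHom (algebraMap R S)))).symm
  have h₄ : algebraMap (x.asIdeal.under R).ResidueField x.asIdeal.ResidueField (algebraMap R _ a) =
      algebraMap S _ (algebraMap R S a) := by
    rw [← IsScalarTower.algebraMap_apply, ← IsScalarTower.algebraMap_apply]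
  change f.residueFieldMap x (e₁ (algebraMap R _ a)) = e₂ (algebraMap _ _ (algebraMap R _ a))
  rw [h₁, h₄, h₂]
  exact (Scheme.Γevaluation_naturality_apply f x _).trans (congrArg _ h₃)

theorem finsum_fibreMult_mul_residueDegree_specMap [Module.Finite R S] [Module.Flat R S]
    (y : PrimeSpectrum R) :
    let f := Spec.map (CommRingCat.ofHom (algebraMap R S))
    ∑ᶠ x : {x : Spec (.of S) // f x = y}, fibreMult f x.1 * f.residueDegree x.1 = f.finrank y := by
  intro f
  have hfin : Finite (y.asIdeal.primesOver S) :=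
    Algebra.QuasiFinite.finite_primesOver y.asIdeal
  have := Fintype.ofFinite (y.asIdeal.primesOver S)
  rw [Scheme.Hom.finrank_SpecMap_algebraMap, ← Ideal.finrank_fiber_eq_rankAtStalk,
    ← Ideal.sum_ramification_inertia_eq_finrank_fiber, ← finsum_eq_sum_of_fintype]
  refine finsum_eq_of_bijective (fun x => (⟨x.1.asIdeal, x.1.2, ⟨?_⟩⟩ : y.asIdeal.primesOver S))
    ⟨?_, ?_⟩ ?_
  · exact (congrArg PrimeSpectrum.asIdeal x.2).symm
  · intro x x' h
    exact Subtype.ext (PrimeSpectrum.ext (congrArg Subtype.val h))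
  · rintro ⟨q, hq, hqy⟩
    exact ⟨⟨⟨q, hq⟩, PrimeSpectrum.ext hqy.over.symm⟩, rfl⟩
  · intro x
    exact congrArg₂ (· * ·) (fibreMult_specMap x.1) (residueDegree_specMap x.1)

end Spec

/-- The degree of the scheme-theoretic fibre of a finite flat morphism over any point is the rank
of the morphism. The statement is local on the target, and for affine schemes it is the sum formula
for ramification indices and inertia degrees. -/
theorem finsum_fibreMult_mul_residueDegree {X Y : Scheme.{u}} (f : X ⟶ Y) [IsFinite f] [Flat f]
    (y : Y) :
    ∑ᶠ x : {x : X // f x = y}, fibreMult f x.1 * f.residueDegree x.1 = f.finrank y := by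
  obtain ⟨A, j, hj, z, rfl⟩ : ∃ (A : CommRingCat.{u}) (j : Spec A ⟶ Y) (_ : IsOpenImmersion j)
      (z : Spec A), j z = y := by
    obtain ⟨z, hz⟩ := Y.affineCover.covers y
    exact ⟨_, Y.affineCover.f (Y.affineCover.idx y), Y.affineCover.map_prop _, z, hz⟩
  -- The base change to `Spec A` is affine, as `f` is finite.
  obtain ⟨B, φ, i, hsq⟩ : ∃ (B : CommRingCat.{u}) (φ : A ⟶ B) (i : Spec B ⟶ X),
      IsPullback i (Spec.map φ) f j := by
    have : IsAffine (Limits.pullback f j) := isAffine_of_isAffineHom (Limits.pullback.snd f j)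
    let P := Limits.pullback f j
    refine ⟨Γ(P, ⊤), Spec.preimage (P.isoSpec.inv ≫ Limits.pullback.snd f j),
      P.isoSpec.inv ≫ Limits.pullback.fst f j, ?_⟩
    rw [Spec.map_preimage]
    exact IsPullback.of_iso (IsPullback.of_hasPullback f j) P.isoSpec (Iso.refl _) (Iso.refl _)
      (Iso.refl _) (by simp) (by simp) (by simp) (by simp)
  have hi : IsOpenImmersion i := MorphismProperty.of_isPullback hsq.flip hj
  have hfin : IsFinite (Spec.map φ) := MorphismProperty.of_isPullback hsq inferInstance
  have hflat : Flat (Spec.map φ) := MorphismProperty.of_isPullback hsq inferInstance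
  rw [← Scheme.Hom.finrank_of_isPullback _ _ _ _ hsq]
  let := φ.hom.toAlgebra
  have : Module.Finite A B := IsFinite.SpecMap_iff φ |>.1 hfin
  have : Module.Flat A B := Flat.SpecMap_iff.1 hflat
  refine Eq.trans (Eq.symm ?_) (finsum_fibreMult_mul_residueDegree_specMap (R := A) (S := B) z)
  have hcomm (x : Spec B) : f (i x) = j (Spec.map φ x) := by
    rw [← Scheme.Hom.comp_apply, ← Scheme.Hom.comp_apply, hsq.w]
  refine finsum_eq_of_bijective (fun x => ⟨i x.1, (hcomm x.1).trans (congrArg j x.2)⟩) ⟨?_, ?_⟩ ?_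
  · intro x x' h
    exact Subtype.ext (i.isOpenEmbedding.injective (congrArg Subtype.val h))
  · rintro ⟨x, hx⟩
    obtain ⟨w, hw, hwz⟩ := Scheme.exists_preimage_of_isPullback hsq x z hx
    exact ⟨⟨w, hwz⟩, Subtype.ext hw⟩
  · intro x
    refine congrArg₂ (· * ·) ?_ ?_
    · change fibreMult (Spec.map φ) x.1 = fibreMult f (i x.1)
      rw [← fibreMult_comp_left, hsq.w, fibreMult_comp_right]
    · change (Spec.map φ).residueDegree x.1 = f.residueDegree (i x.1)
      have h1 := residueDegree_comp i f x.1
      have h2 := residueDegree_comp (Spec.map φ) j x.1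
      rw [residueDegree_of_isOpenImmersion i, mul_one] at h1
      rw [residueDegree_of_isOpenImmersion j, one_mul] at h2
      rw [← h1, ← h2, hsq.w]

end Fibre

section Pullback

theorem isClosed_singleton_of_map {X Y : Scheme.{u}} (f : X ⟶ Y) [IsFinite f] {x : X}
    (h : IsClosed {f x}) : IsClosed {x} := by
  have hc : IsClosed (f ⁻¹' {f x}) := h.preimage f.continuous
  have hd : DiscreteTopology (f ⁻¹' {f x}) := (f.isDiscrete_preimage_singleton (f x)).to_subtype
  have := hc.isClosedEmbedding_subtypeVal.isClosedMap {⟨x, rfl⟩} (isClosed_discrete _)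
  simpa using this

theorem pullbackCycle_apply {X Y : Scheme.{u}} (f : X ⟶ Y) [IsFinite f] (γ : ZeroCycle Y)
    (x : closedPoints X) : pullbackCycle f γ x = γ (mapClosed f x) * fibreMult f x.1 := rfl

theorem pullbackCycle_zero {X Y : Scheme.{u}} (f : X ⟶ Y) [IsFinite f] :
    pullbackCycle f 0 = 0 := by
  ext x
  simp [pullbackCycle_apply]

theorem pullbackCycle_add {X Y : Scheme.{u}} (f : X ⟶ Y) [IsFinite f] (γ γ' : ZeroCycle Y) :
    pullbackCycle f (γ + γ') = pullbackCycle f γ + pullbackCycle f γ' := by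
  ext x
  simp [pullbackCycle_apply, add_mul]

variable {k : Type u} [Field k]

theorem cycleDegree_add {X : Scheme.{u}} (p : X ⟶ Spec (.of k)) (α β : ZeroCycle X) :
    cycleDegree p (α + β) = cycleDegree p α + cycleDegree p β :=
  Finsupp.sum_add_index' (fun _ => zero_mul _) fun _ _ _ => add_mul _ _ _

theorem cycleDegree_pullbackCycle_single {X Y : Scheme.{u}} (pY : Y ⟶ Spec (.of k)) (f : X ⟶ Y)
    [IsFinite f] [Flat f] (y : closedPoints Y) (n : ℕ) :
    cycleDegree (f ≫ pY) (pullbackCycle f (Finsupp.single y n)) =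
      f.finrank y.1 * (n * pY.residueDegree y.1) := by
  classical
  let g : closedPoints X → ℕ := fun x =>
    pullbackCycle f (Finsupp.single y n) x * (f ≫ pY).residueDegree x.1
  -- The points over the closed point `y` are closed, since finite morphisms have discrete fibres.
  let e : {x : X // f x = y.1} → closedPoints X := fun x =>
    ⟨x.1, isClosed_singleton_of_map f (by rw [x.2]; exact y.2)⟩
  have he : Function.Injective e := fun x x' h => Subtype.ext (congrArg (fun z => z.1) h)
  have hfin : Finite {x : X // f x = y.1} := f.finite_preimage_singleton y.1
  have h1 : cycleDegree (f ≫ pY) (pullbackCycle f (Finsupp.single y n)) = ∑ᶠ x, g x := by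
    refine (finsum_eq_sum_of_support_subset _ fun x hx => ?_).symm
    rw [Finset.mem_coe, Finsupp.mem_support_iff]
    exact left_ne_zero_of_mul hx
  have h2 : ∑ᶠ x, g x = ∑ᶠ x ∈ Set.range e, g x := by
    rw [← finsum_mem_univ]
    refine finsum_mem_inter_support_eq' _ _ _ fun x hx => ⟨fun _ => ?_, fun _ => trivial⟩
    have hy : y = mapClosed f x := by
      by_contra hne
      refine left_ne_zero_of_mul (left_ne_zero_of_mul hx) ?_
      exact Finsupp.single_eq_of_ne' hne
    exact ⟨⟨x.1, (congrArg (fun z => z.1) hy).symm⟩, rfl⟩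
  rw [h1, h2, finsum_mem_range he, ← finsum_fibreMult_mul_residueDegree f y.1,
    finsum_mul]
  refine finsum_congr fun x => ?_
  have hx : mapClosed f (e x) = y := Subtype.ext x.2
  have hx' : pY.residueDegree (f x.1) = pY.residueDegree y.1 := by rw [x.2]
  change Finsupp.single y n (mapClosed f (e x)) * fibreMult f x.1 * (f ≫ pY).residueDegree x.1 = _
  rw [hx, Finsupp.single_eq_same, residueDegree_comp, hx']
  ring

/-- Pulling back zero-cycles along a finite flat morphism of degree `δ` multiplies degrees
by `δ`. -/
theorem cycleDegree_pullbackCycle {X Y : Scheme.{u}} (pY : Y ⟶ Spec (.of k)) (f : X ⟶ Y)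
    [IsFinite f] [Flat f] {δ : ℕ} (hδ : ∀ y : Y, f.finrank y = δ) (γ : ZeroCycle Y) :
    cycleDegree (f ≫ pY) (pullbackCycle f γ) = δ * cycleDegree pY γ := by
  induction γ using Finsupp.induction_linear with
  | zero => simp [pullbackCycle_zero, cycleDegree]
  | add γ γ' h h' => rw [pullbackCycle_add, cycleDegree_add, cycleDegree_add, h, h', mul_add]
  | single y n =>
    rw [cycleDegree_pullbackCycle_single, hδ, cycleDegree, Finsupp.sum_single_index (by simp)]

end Pullback

/-! ### Analytic properties of the zeta function -/

section Zeta

variable {k : Type u} [Field k]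

/-- A scheme finite over a scheme of finite type of dimension at most `d` has `O(q ^ (d m))`
points over the extension of degree `m`. -/
theorem exists_numPoints_le [Finite k] {X Y : Scheme.{u}} (pY : Y ⟶ Spec (.of k)) [LocallyOfFiniteType pY]
    [QuasiCompact pY] (f : X ⟶ Y) [IsFinite f] {d : ℕ} (hd : topologicalKrullDim Y ≤ d) :
    ∃ C : ℕ, ∀ n : ℕ, Finite {g : Spec (.of (Ext k (n + 1))) ⟶ X //
        g ≫ f ≫ pY = Spec.map (CommRingCat.ofHom (algebraMap k (Ext k (n + 1))))} ∧
      (numPoints (f ≫ pY) (n + 1) : ℝ) ≤ C * ((Nat.card k : ℝ) ^ d) ^ (n + 1) := by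
  obtain ⟨C, hC⟩ := exists_card_points_le pY f hd
  refine ⟨C, fun n => ⟨(hC _).1, ?_⟩⟩
  have h := (hC (Ext k (n + 1))).2
  rw [natCard_ext n.succ_ne_zero, ← pow_mul, mul_comm (n + 1) d, pow_mul] at h
  exact_mod_cast h

theorem summable_logZetaTerm [Finite k] {X Y : Scheme.{u}} (pY : Y ⟶ Spec (.of k)) [LocallyOfFiniteType pY]
    [QuasiCompact pY] (f : X ⟶ Y) [IsFinite f] {d : ℕ} (hd : topologicalKrullDim Y ≤ d) {t : ℝ}
    (ht₀ : 0 ≤ t) (ht : t < ((Nat.card k : ℝ) ^ d)⁻¹) : Summable (logZetaTerm (f ≫ pY) t) := by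
  obtain ⟨C, hC⟩ := exists_numPoints_le pY f hd
  have hq : 0 < (Nat.card k : ℝ) := by exact_mod_cast Nat.card_pos
  refine summable_div_mul_pow (numPoints (f ≫ pY)) C ((Nat.card k : ℝ) ^ d) (by positivity)
    (fun n => (hC n).2) ht₀ ?_
  have h := mul_lt_mul_of_pos_right ht (pow_pos hq d)
  rwa [inv_mul_cancel₀ (pow_pos hq d).ne'] at h

/-- The zeta function is the generating function of effective zero-cycles by degree. -/
theorem hasSum_pow_cycleDegree [Finite k] {Y : Scheme.{u}} (pY : Y ⟶ Spec (.of k))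
    [LocallyOfFiniteType pY] [QuasiCompact pY] {d : ℕ} (hd : topologicalKrullDim Y ≤ d)
    {t : ℝ} (ht₀ : 0 ≤ t) (ht : t < ((Nat.card k : ℝ) ^ d)⁻¹) :
    HasSum (fun γ : ZeroCycle Y => t ^ cycleDegree pY γ) (zeta pY t) := by
  have hq : 1 ≤ (Nat.card k : ℝ) := by exact_mod_cast Nat.card_pos
  have ht₁ : t < 1 := ht.trans_le (inv_le_one_of_one_le₀ (one_le_pow₀ hq))
  have hs := summable_logZetaTerm pY (𝟙 Y) hd ht₀ ht
  obtain ⟨C, hC⟩ := exists_numPoints_le pY (𝟙 Y) hd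
  simp only [Category.id_comp] at hs hC
  refine hasSum_pow_degree (fun x : closedPoints Y => pY.residueDegree x.1)
    (fun x => residueDegree_pos pY x.2) (numPoints pY) (fun n => ?_) ht₀ ht₁ hs
  have := (hC n).1
  exact hasSum_numPoints pY n.succ_ne_zero

/-- Below the radius `q ^ (-d)` the logarithm of the zeta function can be differentiated, and
`t * Z'(t) / Z(t)` is the mean degree of an effective zero-cycle. -/
theorem hasDerivAt_log_zeta [Finite k] {Y : Scheme.{u}} (pY : Y ⟶ Spec (.of k))
    [LocallyOfFiniteType pY] [QuasiCompact pY] {d : ℕ} (hd : topologicalKrullDim Y ≤ d)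
    {t : ℝ} (ht₀ : 0 < t) (ht : t < ((Nat.card k : ℝ) ^ d)⁻¹) :
    HasDerivAt (fun s => Real.log (zeta pY s))
      ((∑' γ : ZeroCycle Y, (cycleDegree pY γ : ℝ) * t ^ (cycleDegree pY γ - 1)) / zeta pY t) t := by
  obtain ⟨s, hts, hs⟩ := exists_between ht
  have h := hasDerivAt_tsum_pow (cycleDegree pY) ht₀ hts
    (hasSum_pow_cycleDegree pY hd (ht₀.le.trans hts.le) hs).summable
  have heq : zeta pY =ᶠ[nhds t] fun r : ℝ => ∑' γ, r ^ cycleDegree pY γ := by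
    filter_upwards [Ioo_mem_nhds ht₀ ht] with r hr
    exact (hasSum_pow_cycleDegree pY hd hr.1.le hr.2).tsum_eq.symm
  exact (h.congr_of_eventuallyEq heq).log (Real.exp_pos _).ne'

theorem summable_cycleDegree_mul_pow [Finite k] {Y : Scheme.{u}} (pY : Y ⟶ Spec (.of k))
    [LocallyOfFiniteType pY] [QuasiCompact pY] {d : ℕ} (hd : topologicalKrullDim Y ≤ d)
    {t : ℝ} (ht₀ : 0 ≤ t) (ht : t < ((Nat.card k : ℝ) ^ d)⁻¹) :
    Summable fun γ : ZeroCycle Y => (cycleDegree pY γ : ℝ) * t ^ cycleDegree pY γ := by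
  obtain ⟨s, hts, hs⟩ := exists_between ht
  exact summable_mul_pow _ ht₀ hts (hasSum_pow_cycleDegree pY hd (ht₀.trans hts.le) hs).summable

/-- Since degrees are multiplied by `δ` under pullback, the terms of the information loss are affine
functions of the degree, weighted by `t ^ deg γ / Z(Y, t)`. -/
theorem infoLossTerm_eq {X Y : Scheme.{u}} (pY : Y ⟶ Spec (.of k)) (f : X ⟶ Y) [IsFinite f] [Flat f] {δ : ℕ}
    (hδ : ∀ y : Y, f.finrank y = δ) {t : ℝ} (ht : 0 < t) (γ : ZeroCycle Y) :
    infoLossTerm (f ≫ pY) pY f t γ =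
      (Real.log (zeta pY t / zeta (f ≫ pY) t) / zeta pY t) * t ^ cycleDegree pY γ +
        (((δ : ℝ) - 1) * Real.log t / zeta pY t) *
          ((cycleDegree pY γ : ℝ) * t ^ cycleDegree pY γ) := by
  have hX : zeta (f ≫ pY) t ≠ 0 := (Real.exp_pos _).ne'
  have hY : zeta pY t ≠ 0 := (Real.exp_pos _).ne'
  have hlog : Real.log (t ^ (δ * cycleDegree pY γ) / zeta (f ≫ pY) t /
      (t ^ cycleDegree pY γ / zeta pY t)) =
      Real.log (zeta pY t / zeta (f ≫ pY) t) + ((δ : ℝ) - 1) * cycleDegree pY γ * Real.log t := by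
    rw [Real.log_div (by positivity) (by positivity), Real.log_div (by positivity) hX,
      Real.log_div (by positivity) hY, Real.log_div hY hX, Real.log_pow, Real.log_pow]
    push_cast
    ring
  rw [infoLossTerm, cycleDist, cycleDist, cycleDegree_pullbackCycle pY f hδ, hlog]
  ring

end Zeta

end HasseWeil

theorem lemma4p8 {k : Type u} [Field k] [Finite k] {X Y : Scheme.{u}}
    (pX : X ⟶ Spec (.of k)) (pY : Y ⟶ Spec (.of k))
    [LocallyOfFiniteType pY] [QuasiCompact pY]
    (f : X ⟶ Y) (hf : f ≫ pY = pX) [IsFinite f] [Flat f] [Surjective f]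
    (δ : ℕ) (hδ : ∀ y : Y, f.finrank y = δ)
    (d : ℕ) (hd : topologicalKrullDim Y ≤ d)
    (t : ℝ) (ht₀ : 0 < t) (ht : t < ((Nat.card k : ℝ) ^ d)⁻¹) :
    Summable (HasseWeil.logZetaTerm pX t) ∧
    Summable (HasseWeil.logZetaTerm pY t) ∧
    DifferentiableAt ℝ (fun s : ℝ => Real.log (HasseWeil.zeta pY s)) t ∧
    Summable (HasseWeil.infoLossTerm pX pY f t) ∧
    HasseWeil.infoLoss pX pY f t =
      Real.log (HasseWeil.zeta pY t / HasseWeil.zeta pX t) +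
        ((δ : ℝ) - 1) * (t * Real.log t * deriv (fun s : ℝ => Real.log (HasseWeil.zeta pY s)) t) := by
  subst hf
  have hY : HasseWeil.zeta pY t ≠ 0 := (Real.exp_pos _).ne'
  have hderiv := HasseWeil.hasDerivAt_log_zeta pY hd ht₀ ht
  have hterm := (((HasseWeil.hasSum_pow_cycleDegree pY hd ht₀.le ht).mul_left
      (Real.log (HasseWeil.zeta pY t / HasseWeil.zeta (f ≫ pY) t) / HasseWeil.zeta pY t)).add
    ((HasseWeil.summable_cycleDegree_mul_pow pY hd ht₀.le ht).hasSum.mul_left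
      (((δ : ℝ) - 1) * Real.log t / HasseWeil.zeta pY t)))
  simp only [← HasseWeil.infoLossTerm_eq pY f hδ ht₀] at hterm
  refine ⟨HasseWeil.summable_logZetaTerm pY f hd ht₀.le ht, ?_, hderiv.differentiableAt,
    hterm.summable, ?_⟩
  · simpa only [Category.id_comp] using HasseWeil.summable_logZetaTerm pY (𝟙 Y) hd ht₀.le ht
  · rw [HasseWeil.infoLoss, hterm.tsum_eq, hderiv.deriv]
    -- `t * n * t ^ (n - 1) = n * t ^ n` also for `n = 0`, where the subtraction is truncated.
    have hshift : ∑' γ, (HasseWeil.cycleDegree pY γ : ℝ) * t ^ HasseWeil.cycleDegree pY γ =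
        t * ∑' γ, (HasseWeil.cycleDegree pY γ : ℝ) * t ^ (HasseWeil.cycleDegree pY γ - 1) := by
      rw [← tsum_mul_left]
      refine tsum_congr fun γ => ?_
      rcases HasseWeil.cycleDegree pY γ with _ | n
      · simp
      · rw [Nat.add_sub_cancel, pow_succ]
        ring
    rw [hshift]
    field_simp
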